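/- Let $K$ and $S$ be compact Hausdorff spaces, with $K$ nonempty. Let $C(K)$ and $C(S)$ be the complex Banach spaces of complex-valued continuous functions on $K$ and $S$, respectively, endowed with the supremum norm, and let $L(C(K),C(S))$ be the Banach space of bounded linear operators $C(K)\to C(S)$ with the operator norm. Let $$NA(C(K),C(S))=\{T\in L(C(K),C(S)) : \|Tf\|=\|T\| \text{ for some } f\in C(K) \text{ with } \|f\|=1\}$$ be the set of norm-attaining operators. Then $$\overline{NA(C(K),C(S))}=L(C(K),C(S)),$$ where the closure is taken in the operator norm. -/

import Mathlib

/-- A bounded linear operator attains its norm if `‖T x‖ = ‖T‖` for some unit vector `x`. -/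
def NormAttaining {𝕜 X Y : Type*} [NontriviallyNormedField 𝕜]
    [NormedAddCommGroup X] [NormedSpace 𝕜 X] [NormedAddCommGroup Y] [NormedSpace 𝕜 Y]
    (T : X →L[𝕜] Y) : Prop :=
  ∃ x : X, ‖x‖ = 1 ∧ ‖T x‖ = ‖T‖

/-! The value of `T` at a point of `S` is a functional on C(K), whose norm dominates the sum of the
norms of its pieces under a cutoff φ + (1 - φ). With uniform convexity of the disc, two functions
almost norming the same functional can be far apart only where it has little mass
(`norm_apply_mul_le_of_two_near_norming`). Let f₀ almost norm T, with error η. `exists_boost`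
perturbs T so that a better f₁ peaks only where f₀ is still almost norming; `exists_cut` discards
the small mass where they differ, and `exists_clip` brings f₁ within δ of f₀ by changing it only
there. The error is now arbitrarily small, while T has moved by O(η/δ²) and f₀ by δ. Iterating with
summable moves, operators and functions both converge, and the limit operator attains its norm at
the limit function. -/

namespace ContinuousMap

/-- A real-valued continuous function, viewed as a complex-valued one. -/
noncomputable def toComplex {X : Type*} [TopologicalSpace X] (φ : C(X, ℝ)) : C(X, ℂ) :=
  ⟨fun x => (φ x : ℂ), by fun_prop⟩

@[simp]
lemma toComplex_apply {X : Type*} [TopologicalSpace X] (φ : C(X, ℝ)) (x : X) :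
    φ.toComplex x = (φ x : ℂ) := rfl

lemma exists_bump {S : Type*} [TopologicalSpace S] [CompactSpace S] [T2Space S]
    {U : Set S} (hU : IsOpen U) {s : S} (hs : s ∈ U) :
    ∃ h : C(S, ℝ), h s = 1 ∧ (∀ t, t ∉ U → h t = 0) ∧ ∀ t, 0 ≤ h t ∧ h t ≤ 1 := by
  obtain ⟨h, h0, h1, h2⟩ := exists_continuous_zero_one_of_isClosed (s := Uᶜ) (t := {s})
    hU.isClosed_compl isClosed_singleton (by simpa using hs)
  exact ⟨h, h1 rfl, fun t ht => h0 ht, h2⟩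

lemma exists_lt_norm_apply {S : Type*} [TopologicalSpace S] [CompactSpace S]
    {g : C(S, ℂ)} {r : ℝ} (hr : 0 ≤ r) (h : r < ‖g‖) : ∃ s, r < ‖g s‖ := by
  by_contra! H
  exact absurd ((ContinuousMap.norm_le g hr).2 H) (not_le.2 h)

end ContinuousMap

open ContinuousMap

/-! ### Functionals on C(K) and their near-norming functions -/

section Functional

variable {K : Type*} [TopologicalSpace K] [CompactSpace K]

lemma norm_apply_le_of_norm_le_one {E F : Type*} [SeminormedAddCommGroup E] [NormedSpace ℂ E]
    [SeminormedAddCommGroup F] [NormedSpace ℂ F] (T : E →L[ℂ] F) {x : E} (hx : ‖x‖ ≤ 1) :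
    ‖T x‖ ≤ ‖T‖ :=
  (T.le_opNorm x).trans (mul_le_of_le_one_right (norm_nonneg _) hx)

lemma exists_unimodular_mul_eq_norm (z : ℂ) : ∃ u : ℂ, ‖u‖ = 1 ∧ u * z = (‖z‖ : ℂ) := by
  rcases eq_or_ne z 0 with rfl | hz
  · exact ⟨1, by simp⟩
  · have h : (‖z‖ : ℂ) ≠ 0 := by simpa using hz
    refine ⟨(starRingEnd ℂ) z / ‖z‖, by simp [hz], ?_⟩
    rw [div_mul_eq_mul_div, mul_comm, Complex.mul_conj, Complex.normSq_eq_norm_sq]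
    push_cast
    field_simp

lemma norm_toComplex_mul_add_le_one {φ : C(K, ℝ)} (hφ : ∀ x, 0 ≤ φ x ∧ φ x ≤ 1) {g k : C(K, ℂ)}
    (hg : ‖g‖ ≤ 1) (hk : ‖k‖ ≤ 1) :
    ‖φ.toComplex * g + (1 - φ.toComplex) * k‖ ≤ 1 := by
  refine (ContinuousMap.norm_le _ zero_le_one).2 fun x => ?_
  have hgx := (g.norm_coe_le_norm x).trans hg
  have hkx := (k.norm_coe_le_norm x).trans hk
  obtain ⟨h0, h1⟩ := hφ x
  have e : (1 : ℂ) - (φ x : ℂ) = ((1 - φ x : ℝ) : ℂ) := by push_cast; rfl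
  calc ‖(φ x : ℂ) * g x + (1 - (φ x : ℂ)) * k x‖
      ≤ φ x * ‖g x‖ + (1 - φ x) * ‖k x‖ := by
        refine (norm_add_le _ _).trans (le_of_eq ?_)
        rw [e, norm_mul, norm_mul, Complex.norm_real, Complex.norm_real,
          Real.norm_of_nonneg h0, Real.norm_of_nonneg (by linarith)]
    _ ≤ 1 := by nlinarith

lemma norm_one_sub_toComplex_mul_le_one {φ : C(K, ℝ)} (hφ : ∀ x, 0 ≤ φ x ∧ φ x ≤ 1)
    {g : C(K, ℂ)} (hg : ‖g‖ ≤ 1) : ‖(1 - φ.toComplex) * g‖ ≤ 1 := by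
  simpa using norm_toComplex_mul_add_le_one hφ (g := 0) (by simp) hg

/-- Rotating `g` and `k` makes both values nonnegative, and the convex combination of the rotated
functions stays in the unit ball. -/
lemma norm_apply_mul_add_norm_apply_le (L : C(K, ℂ) →L[ℂ] ℂ) {φ : C(K, ℝ)}
    (hφ : ∀ x, 0 ≤ φ x ∧ φ x ≤ 1) {g k : C(K, ℂ)} (hg : ‖g‖ ≤ 1) (hk : ‖k‖ ≤ 1) :
    ‖L (φ.toComplex * g)‖ + ‖L ((1 - φ.toComplex) * k)‖ ≤ ‖L‖ := by
  obtain ⟨u, hu, hu'⟩ := exists_unimodular_mul_eq_norm (L (φ.toComplex * g))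
  obtain ⟨v, hv, hv'⟩ := exists_unimodular_mul_eq_norm (L ((1 - φ.toComplex) * k))
  have h := norm_apply_le_of_norm_le_one L (norm_toComplex_mul_add_le_one hφ (g := u • g)
    (k := v • k) (by rwa [norm_smul, hu, one_mul]) (by rwa [norm_smul, hv, one_mul]))
  rw [map_add, mul_smul_comm, mul_smul_comm, map_smul, map_smul, smul_eq_mul, smul_eq_mul, hu', hv',
    ← Complex.ofReal_add, Complex.norm_real, Real.norm_of_nonneg (by positivity)] at h
  exact h

/-- Near-norming functions remain near-norming, with the same error, after localization. -/
lemma norm_apply_mul_le_re_add (L : C(K, ℂ) →L[ℂ] ℂ) {φ : C(K, ℝ)}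
    (hφ : ∀ x, 0 ≤ φ x ∧ φ x ≤ 1) {f g : C(K, ℂ)} (hf : ‖f‖ ≤ 1) (hg : ‖g‖ ≤ 1) {ε : ℝ}
    (h : ‖L‖ ≤ (L f).re + ε) : ‖L (φ.toComplex * g)‖ ≤ (L (φ.toComplex * f)).re + ε := by
  have h1 := norm_apply_mul_add_norm_apply_le L hφ hg hf
  have h2 := Complex.re_le_norm (L ((1 - φ.toComplex) * f))
  have h3 : (L f).re = (L (φ.toComplex * f)).re + (L ((1 - φ.toComplex) * f)).re := by
    rw [← Complex.add_re, ← map_add]; congr 2; ring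
  linarith

lemma norm_one_sub_apply_mul_le_re_add (L : C(K, ℂ) →L[ℂ] ℂ) {φ : C(K, ℝ)}
    (hφ : ∀ x, 0 ≤ φ x ∧ φ x ≤ 1) {f g : C(K, ℂ)} (hf : ‖f‖ ≤ 1) (hg : ‖g‖ ≤ 1) {ε : ℝ}
    (h : ‖L‖ ≤ (L f).re + ε) :
    ‖L ((1 - φ.toComplex) * g)‖ ≤ (L ((1 - φ.toComplex) * f)).re + ε := by
  have h1 := norm_apply_mul_add_norm_apply_le L hφ hf hg
  have h2 := Complex.re_le_norm (L (φ.toComplex * f))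
  have h3 : (L f).re = (L (φ.toComplex * f)).re + (L ((1 - φ.toComplex) * f)).re := by
    rw [← Complex.add_re, ← map_add]; congr 2; ring
  linarith

lemma opNorm_le_of_forall_norm_le_one {E F : Type*} [NormedAddCommGroup E] [NormedSpace ℂ E]
    [NormedAddCommGroup F] [NormedSpace ℂ F] (T : E →L[ℂ] F) {C : ℝ} (hC : 0 ≤ C)
    (h : ∀ x, ‖x‖ ≤ 1 → ‖T x‖ ≤ C) : ‖T‖ ≤ C :=
  ContinuousLinearMap.opNorm_le_of_unit_norm hC fun x hx => h x hx.le

/-- Uniform convexity from the parallelogram law, with 1 - δ²/16 ≤ (1 - δ²/32)². -/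
lemma norm_half_add_le {a b : ℂ} (ha : ‖a‖ ≤ 1) (hb : ‖b‖ ≤ 1) {δ : ℝ} (hδ : 0 < δ)
    (hab : δ / 2 ≤ ‖a - b‖) : ‖(1 / 2 : ℂ) * (a + b)‖ ≤ 1 - δ ^ 2 / 32 := by
  have h := parallelogram_law_with_norm ℝ a b
  have e : ‖(1 / 2 : ℂ) * (a + b)‖ = ‖a + b‖ / 2 := by
    rw [norm_mul]; norm_num; ring
  have h1 : ‖a - b‖ ≤ 2 := (norm_sub_le a b).trans (by linarith)
  have hd : δ ≤ 4 := by linarith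
  rw [e]
  have h2 : (‖a + b‖ / 2) ^ 2 ≤ (1 - δ ^ 2 / 32) ^ 2 := by
    have : (δ / 2) ^ 2 ≤ ‖a - b‖ ^ 2 := by gcongr
    have : ‖a‖ ^ 2 ≤ 1 := by nlinarith [norm_nonneg a]
    have : ‖b‖ ^ 2 ≤ 1 := by nlinarith [norm_nonneg b]
    nlinarith [sq_nonneg (δ ^ 2)]
  exact le_of_sq_le_sq h2 (by nlinarith)

/-- Two near-norming functions for the same functional agree up to `δ` off a set of small mass. -/
lemma norm_apply_mul_le_of_two_near_norming (L : C(K, ℂ) →L[ℂ] ℂ) {φ : C(K, ℝ)}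
    (hφ : ∀ x, 0 ≤ φ x ∧ φ x ≤ 1) {f₀ f₁ : C(K, ℂ)} (hf₀ : ‖f₀‖ ≤ 1) (hf₁ : ‖f₁‖ ≤ 1)
    {ε δ : ℝ} (hδ : 0 < δ) (hδ1 : δ ≤ 1) (h₀ : ‖L‖ ≤ (L f₀).re + ε) (h₁ : ‖L‖ ≤ (L f₁).re + ε)
    (hsupp : ∀ x, φ x ≠ 0 → δ / 2 ≤ ‖f₀ x - f₁ x‖) {g : C(K, ℂ)} (hg : ‖g‖ ≤ 1) :
    ‖L (φ.toComplex * g)‖ ≤ 32 * ε / δ ^ 2 := by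
  set r : ℝ := 1 - δ ^ 2 / 32 with hr
  have hr0 : 0 < r := by nlinarith
  let m : C(K, ℂ) := (1 / 2 : ℂ) • (f₀ + f₁)
  have hmx : ∀ x, m x = (1 / 2 : ℂ) * (f₀ x + f₁ x) := fun x => rfl
  have hmax : ∀ x, 0 < max r ‖m x‖ := fun x => lt_max_of_lt_left hr0
  -- The midpoint is divided by at least r: `m'` stays in the unit ball, and `m = r m'` wherever φ
  -- is nonzero.
  let c : C(K, ℝ) := ⟨fun x => (max r ‖m x‖)⁻¹, by
    refine Continuous.inv₀ (by fun_prop) fun x => (hmax x).ne'⟩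
  let m' : C(K, ℂ) := c.toComplex * m
  have hm' : ‖m'‖ ≤ 1 := by
    refine (ContinuousMap.norm_le _ zero_le_one).2 fun x => ?_
    change ‖(((max r ‖m x‖)⁻¹ : ℝ) : ℂ) * m x‖ ≤ 1
    rw [norm_mul, Complex.norm_real, Real.norm_of_nonneg (inv_nonneg.2 (hmax x).le),
      inv_mul_le_iff₀ (hmax x), mul_one]
    exact le_max_right _ _
  have hφm : φ.toComplex * m = (r : ℂ) • (φ.toComplex * m') := by
    ext x
    change (φ x : ℂ) * m x = r * (φ x * ((((max r ‖m x‖)⁻¹ : ℝ) : ℂ) * m x))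
    by_cases hx : φ x = 0
    · simp [hx]
    · have := norm_half_add_le ((f₀.norm_coe_le_norm x).trans hf₀)
        ((f₁.norm_coe_le_norm x).trans hf₁) hδ (hsupp x hx)
      rw [← hmx] at this
      rw [max_eq_left this]
      have : (r : ℂ) ≠ 0 := by exact_mod_cast hr0.ne'
      rw [Complex.ofReal_inv, mul_left_comm, mul_inv_cancel_left₀ this]
  have hm1 : ‖m‖ ≤ 1 := by
    change ‖(1 / 2 : ℂ) • (f₀ + f₁)‖ ≤ 1
    rw [norm_smul]
    have := norm_add_le f₀ f₁
    norm_num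
    linarith
  have hLm : ‖L‖ ≤ (L m).re + ε := by
    have : (L m).re = ((L f₀).re + (L f₁).re) / 2 := by
      change (L ((1 / 2 : ℂ) • (f₀ + f₁))).re = _
      rw [map_smul, map_add, smul_eq_mul, show (1 / 2 : ℂ) = ((1 / 2 : ℝ) : ℂ) by norm_num,
        Complex.re_ofReal_mul, Complex.add_re]
      ring
    linarith
  set B := ‖L.comp (ContinuousLinearMap.mul ℂ C(K, ℂ) φ.toComplex)‖ with hB
  have hle : ∀ k : C(K, ℂ), ‖k‖ ≤ 1 → ‖L (φ.toComplex * k)‖ ≤ B := fun k hk =>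
    norm_apply_le_of_norm_le_one (L.comp (ContinuousLinearMap.mul ℂ C(K, ℂ) φ.toComplex)) hk
  have hre : (L (φ.toComplex * m)).re ≤ r * B := by
    rw [hφm, map_smul, smul_eq_mul, Complex.re_ofReal_mul]
    exact mul_le_mul_of_nonneg_left ((Complex.re_le_norm _).trans (hle _ hm')) hr0.le
  have key : ∀ k : C(K, ℂ), ‖k‖ ≤ 1 → ‖L (φ.toComplex * k)‖ ≤ r * B + ε := fun k hk =>
    (norm_apply_mul_le_re_add L hφ hm1 hk hLm).trans (by linarith)
  -- Since 1 - r = δ²/32, this self-bound yields B ≤ 32ε/δ².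
  have hBle : B ≤ r * B + ε :=
    opNorm_le_of_forall_norm_le_one _ ((norm_nonneg _).trans (key 0 (by simp))) key
  refine (hle g hg).trans ?_
  have hrB : r * B = B - B * δ ^ 2 / 32 := by rw [hr]; ring
  rw [le_div_iff₀ (by positivity)]
  linarith

end Functional

/-! ### Perturbing operators into C(S) -/

section Operator

/-- Evaluation of an operator at a point. -/
noncomputable def evalFunctional {K S : Type*} [TopologicalSpace K]
    [TopologicalSpace S] (T : C(K, ℂ) →L[ℂ] C(S, ℂ)) (s : S) : C(K, ℂ) →L[ℂ] ℂ :=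
  (ContinuousMap.evalCLM ℂ s).comp T

@[simp]
lemma evalFunctional_apply {K S : Type*} [TopologicalSpace K] [TopologicalSpace S]
    (T : C(K, ℂ) →L[ℂ] C(S, ℂ)) (s : S) (f : C(K, ℂ)) :
    evalFunctional T s f = T f s := rfl

variable {K S : Type*} [TopologicalSpace K] [CompactSpace K] [TopologicalSpace S] [CompactSpace S]

lemma opNorm_le_of_forall_norm_apply_le (T : C(K, ℂ) →L[ℂ] C(S, ℂ)) {C : ℝ} (hC : 0 ≤ C)
    (h : ∀ f, ‖f‖ ≤ 1 → ∀ s, ‖T f s‖ ≤ C) : ‖T‖ ≤ C :=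
  opNorm_le_of_forall_norm_le_one T hC fun f hf => (ContinuousMap.norm_le _ hC).2 (h f hf)

lemma norm_apply_apply_le (T : C(K, ℂ) →L[ℂ] C(S, ℂ)) {f : C(K, ℂ)} (hf : ‖f‖ ≤ 1) (s : S) :
    ‖T f s‖ ≤ ‖T‖ :=
  ((T f).norm_coe_le_norm s).trans (norm_apply_le_of_norm_le_one T hf)

lemma exists_lt_re_apply (T : C(K, ℂ) →L[ℂ] C(S, ℂ)) {r : ℝ} (hr : 0 ≤ r) (h : r < ‖T‖) :
    ∃ f : C(K, ℂ), ‖f‖ ≤ 1 ∧ ∃ s, r < (T f s).re := by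
  obtain ⟨f, hf, hrf⟩ := T.exists_lt_apply_of_lt_opNorm h
  obtain ⟨s, hs⟩ := exists_lt_norm_apply hr hrf
  obtain ⟨u, hu, hu'⟩ := exists_unimodular_mul_eq_norm (T f s)
  refine ⟨u • f, by rw [norm_smul, hu, one_mul]; exact hf.le, s, ?_⟩
  rw [map_smul, ContinuousMap.smul_apply, smul_eq_mul, hu', Complex.ofReal_re]
  exact hs

variable [T2Space S]

/-- Amplifying `T` near a point `s₀` where `f₀` is near-norming makes `f₀` near-norming at every
point where the amplified operator is large. -/
lemma exists_boost (T : C(K, ℂ) →L[ℂ] C(S, ℂ)) (hT : ‖T‖ ≤ 1) {f₀ : C(K, ℂ)} (hf₀ : ‖f₀‖ ≤ 1)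
    {s₀ : S} {η : ℝ} (hη : 0 < η) (hη' : η ≤ 1 / 3) (h₀ : 1 - η ≤ (T f₀ s₀).re) :
    ∃ T' : C(K, ℂ) →L[ℂ] C(S, ℂ), ‖T' - T‖ ≤ 3 * η ∧ 1 + η ≤ ‖T'‖ ∧
      ∀ s f, ‖f‖ ≤ 1 → 1 < ‖T' f s‖ → ‖evalFunctional T' s‖ ≤ (T' f₀ s).re + 4 * η := by
  obtain ⟨h, hs₀, hU, hh⟩ := exists_bump (U := {s | 1 - 2 * η < (T f₀ s).re})
    (isOpen_lt (by fun_prop) (by fun_prop)) (s := s₀) (by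
      change 1 - 2 * η < (T f₀ s₀).re
      linarith)
  -- The gain 3η beats the defect at `s₀`: (1 + 3η)(1 - η) ≥ 1 + η for η ≤ 1/3.
  let T' : C(K, ℂ) →L[ℂ] C(S, ℂ) :=
    T + ((3 * η : ℝ) : ℂ) • (ContinuousLinearMap.mul ℂ C(S, ℂ) h.toComplex).comp T
  have hT' : ∀ f s, T' f s = ((1 + 3 * η * h s : ℝ) : ℂ) * T f s := fun f s => by
    change T f s + ((3 * η : ℝ) : ℂ) * ((h s : ℂ) * T f s) = _
    push_cast; ring
  have hpos : ∀ s, 0 ≤ 1 + 3 * η * h s := fun s => by nlinarith [hh s]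
  have hbd : ∀ f s, ‖f‖ ≤ 1 → ‖T f s‖ ≤ 1 := fun f s hf => (norm_apply_apply_le T hf s).trans hT
  refine ⟨T', ?_, ?_, ?_⟩
  · refine opNorm_le_of_forall_norm_apply_le _ (by positivity) fun f hf s => ?_
    have : (T' - T) f s = ((3 * η * h s : ℝ) : ℂ) * T f s := by
      change T' f s - T f s = _
      rw [hT']; push_cast; ring
    have h3 : 0 ≤ 3 * η * h s := by have := (hh s).1; positivity
    rw [this, norm_mul, Complex.norm_real, Real.norm_of_nonneg h3]
    nlinarith [hbd f s hf, hh s, norm_nonneg (T f s)]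
  · refine le_trans ?_ ((Complex.re_le_norm _).trans (norm_apply_apply_le T' hf₀ s₀))
    rw [hT', Complex.re_ofReal_mul, hs₀]
    nlinarith
  · intro s f hf hlt
    have hs : 1 - 2 * η < (T f₀ s).re := by
      by_contra hs
      have := hbd f s hf
      rw [hT', hU s hs] at hlt
      simp at hlt
      linarith
    refine opNorm_le_of_forall_norm_le_one _ ?_ fun g hg => ?_
    · rw [hT', Complex.re_ofReal_mul]
      have := mul_nonneg (hpos s) (by linarith : 0 ≤ (T f₀ s).re)
      positivity
    · rw [evalFunctional_apply, hT', hT', norm_mul, Complex.norm_real,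
        Real.norm_of_nonneg (hpos s), Complex.re_ofReal_mul]
      have h2 : 1 + 3 * η * h s ≤ 2 := by nlinarith [hh s]
      nlinarith [hbd g s hg, hpos s]

/-- If `φ` carries little mass near a point `s₁` where `f₁` is near-norming, then `T` can be
perturbed so as to ignore `φ` at `s₁` while `f₁` stays near-norming with comparable error. -/
lemma exists_cut (T : C(K, ℂ) →L[ℂ] C(S, ℂ)) (hT : 1 ≤ ‖T‖) {f₁ : C(K, ℂ)} (hf₁ : ‖f₁‖ ≤ 1)
    {s₁ : S} {η τ : ℝ} (hη : 0 < η) (h₁ : ‖T‖ - η ≤ (T f₁ s₁).re) {φ : C(K, ℝ)}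
    (hφ : ∀ x, 0 ≤ φ x ∧ φ x ≤ 1) (hτη : τ + η ≤ 1 / 2)
    (hτ : ∀ s, ‖T‖ - 2 * η < (T f₁ s).re → ∀ g : C(K, ℂ), ‖g‖ ≤ 1 → ‖T (φ.toComplex * g) s‖ ≤ τ) :
    ∃ T' : C(K, ℂ) →L[ℂ] C(S, ℂ), ‖T'‖ ≤ ‖T‖ + 6 * η ∧
      ‖T' - T‖ ≤ τ + 2 * ‖T‖ * (η + τ) ∧
      ∀ f : C(K, ℂ), (1 - φ.toComplex) * f = (1 - φ.toComplex) * f₁ → (T' f s₁).re = ‖T‖ := by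
  set A := ‖T‖ with hA
  have hsplit : ∀ f s, T f s = T (φ.toComplex * f) s + T ((1 - φ.toComplex) * f) s := by
    intro f s
    rw [← ContinuousMap.add_apply, ← map_add]; congr 2; ring
  set m := (T ((1 - φ.toComplex) * f₁) s₁).re with hm
  have hs₁ : A - 2 * η < (T f₁ s₁).re := by linarith
  have hτ0 : 0 ≤ τ := (norm_nonneg _).trans (hτ s₁ hs₁ 0 (by simp))
  have hmA : A - (η + τ) ≤ m := by
    have h2 := (Complex.re_le_norm _).trans (hτ s₁ hs₁ f₁ hf₁)
    have h3 := congrArg Complex.re (hsplit f₁ s₁)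
    rw [Complex.add_re] at h3
    linarith
  have hmA' : m ≤ A := (Complex.re_le_norm _).trans
    (norm_apply_apply_le T (norm_one_sub_toComplex_mul_le_one hφ hf₁) s₁)
  have hm0 : 1 / 2 ≤ m := by linarith
  have hmpos : 0 < m := by linarith
  -- Rescaling by `l` restores exactly the value lost with φ.
  set l := A / m with hl
  have hlm : l * m = A := div_mul_cancel₀ _ hmpos.ne'
  have hl1 : 1 ≤ l := (one_le_div hmpos).2 hmA'
  have hl2 : l ≤ 2 := (div_le_iff₀ hmpos).2 (by linarith)
  have hl3 : l - 1 ≤ 2 * (η + τ) := by nlinarith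
  -- The second condition bounds the cut functional by m + 3η near `s₁`; as l m = A and l ≤ 2,
  -- rescaling costs at most 6η.
  obtain ⟨h, hhs₁, hU, hh⟩ := exists_bump (U := {s | A - 2 * η < (T f₁ s).re} ∩
      {s | (T ((1 - φ.toComplex) * f₁) s).re < m + η})
    ((isOpen_lt (by fun_prop) (by fun_prop)).inter (isOpen_lt (by fun_prop) (by fun_prop)))
    (s := s₁) ⟨hs₁, by change m < m + η; linarith⟩
  let P : C(K, ℂ) →L[ℂ] C(S, ℂ) :=
    (l : ℂ) • T.comp (ContinuousLinearMap.mul ℂ C(K, ℂ) (1 - φ.toComplex)) - T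
  let D : C(K, ℂ) →L[ℂ] C(S, ℂ) := (ContinuousLinearMap.mul ℂ C(S, ℂ) h.toComplex).comp P
  have hD : ∀ f s, D f s = (h s : ℂ) * ((l : ℂ) * T ((1 - φ.toComplex) * f) s - T f s) :=
    fun f s => rfl
  have hcut : ∀ s, h s ≠ 0 → ∀ g : C(K, ℂ), ‖g‖ ≤ 1 →
      ‖T ((1 - φ.toComplex) * g) s‖ ≤ m + 3 * η := by
    intro s hs g hg
    have hsU := not_imp_comm.1 (hU s) hs
    have hL : ‖evalFunctional T s‖ ≤ (evalFunctional T s f₁).re + 2 * η := by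
      have : ‖evalFunctional T s‖ ≤ A := opNorm_le_of_forall_norm_le_one _ (norm_nonneg _)
        fun k hk => norm_apply_apply_le T hk s
      have := hsU.1
      simp only [Set.mem_ofPred_eq] at this
      rw [evalFunctional_apply]
      linarith
    have h4 := norm_one_sub_apply_mul_le_re_add (evalFunctional T s) hφ hf₁ hg hL
    have h5 := hsU.2
    simp only [Set.mem_ofPred_eq] at h5
    rw [evalFunctional_apply, evalFunctional_apply] at h4
    linarith
  refine ⟨T + D, ?_, ?_, ?_⟩
  · refine opNorm_le_of_forall_norm_apply_le _ (by positivity) fun f hf s => ?_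
    have hTf := norm_apply_apply_le T hf s
    by_cases hs : h s = 0
    · have : (T + D) f s = T f s := by
        change T f s + D f s = _
        rw [hD, hs]; simp
      rw [this]; linarith
    · have : (T + D) f s = ((1 - h s : ℝ) : ℂ) * T f s +
          ((h s * l : ℝ) : ℂ) * T ((1 - φ.toComplex) * f) s := by
        change T f s + D f s = _
        rw [hD]; push_cast; ring
      have h1 := (hh s).1
      have h2 := (hh s).2
      rw [this]
      refine (norm_add_le _ _).trans ?_
      rw [norm_mul, norm_mul, Complex.norm_real, Complex.norm_real,
        Real.norm_of_nonneg (by linarith), Real.norm_of_nonneg (by positivity)]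
      have h6 : l * ‖T ((1 - φ.toComplex) * f) s‖ ≤ A + 6 * η := by
        have := mul_le_mul_of_nonneg_left (hcut s hs f hf) (by linarith : 0 ≤ l)
        nlinarith
      nlinarith
  · rw [add_sub_cancel_left]
    refine opNorm_le_of_forall_norm_apply_le _ (by positivity) fun f hf s => ?_
    by_cases hs : h s = 0
    · rw [hD, hs]
      simp only [Complex.ofReal_zero, zero_mul, norm_zero]
      positivity
    · have hsU := not_imp_comm.1 (hU s) hs
      have e : D f s = (h s : ℂ) * (((l - 1 : ℝ) : ℂ) * T ((1 - φ.toComplex) * f) s -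
          T (φ.toComplex * f) s) := by
        rw [hD, hsplit f s]; push_cast; ring
      have h7 := hτ s hsU.1 f hf
      have h8 := norm_apply_apply_le T (norm_one_sub_toComplex_mul_le_one hφ hf) s
      rw [e, norm_mul, Complex.norm_real, Real.norm_of_nonneg (hh s).1]
      refine (mul_le_of_le_one_left (norm_nonneg _) (hh s).2).trans ((norm_sub_le _ _).trans ?_)
      rw [norm_mul, Complex.norm_real, Real.norm_of_nonneg (by linarith)]
      have : (l - 1) * ‖T ((1 - φ.toComplex) * f) s‖ ≤ 2 * (η + τ) * A := by gcongr
      linarith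
  · intro f hf
    have : (T + D) f s₁ = (l : ℂ) * T ((1 - φ.toComplex) * f₁) s₁ := by
      change T f s₁ + D f s₁ = _
      rw [hD, hhs₁, hf]; push_cast; ring
    rw [this, Complex.re_ofReal_mul, ← hm, hlm]

/-- In the unit ball, `f₁` can be changed into a function within `δ` of `f₀` by altering it only where
a suitable cutoff `φ`, supported where `f₀` and `f₁` are far apart, equals `1`. -/
lemma exists_clip (f₀ f₁ : C(K, ℂ)) (hf₀ : ‖f₀‖ ≤ 1) (hf₁ : ‖f₁‖ ≤ 1) {δ : ℝ} (hδ : 0 < δ) :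
    ∃ (φ : C(K, ℝ)) (f : C(K, ℂ)), (∀ x, 0 ≤ φ x ∧ φ x ≤ 1) ∧
      (∀ x, φ x ≠ 0 → δ / 2 ≤ ‖f₀ x - f₁ x‖) ∧ ‖f‖ ≤ 1 ∧ ‖f - f₀‖ ≤ δ ∧
      (1 - φ.toComplex) * f = (1 - φ.toComplex) * f₁ := by
  let d : K → ℝ := fun x => ‖f₀ x - f₁ x‖
  have hd : Continuous d := by fun_prop
  have hmax : ∀ x, 0 < max δ (d x) := fun x => lt_max_of_lt_left hδ
  let φ : C(K, ℝ) := ⟨fun x => max 0 (min 1 (2 * d x / δ - 1)), by fun_prop⟩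
  have hφx : ∀ x, φ x = max 0 (min 1 (2 * d x / δ - 1)) := fun x => rfl
  -- Truncates f₁ - f₀ radially at δ; φ is already 1 where truncation begins.
  let c : C(K, ℝ) := ⟨fun x => δ / max δ (d x),
    Continuous.div continuous_const (by fun_prop) fun x => (hmax x).ne'⟩
  have hcx : ∀ x, c x = δ / max δ (d x) := fun x => rfl
  have hc : ∀ x, 0 ≤ c x ∧ c x ≤ 1 := fun x =>
    ⟨div_nonneg hδ.le (hmax x).le, (div_le_one (hmax x)).2 (le_max_left _ _)⟩
  refine ⟨φ, c.toComplex * f₁ + (1 - c.toComplex) * f₀, fun x => ⟨le_max_left _ _,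
    max_le zero_le_one (min_le_left _ _)⟩, ?_, norm_toComplex_mul_add_le_one hc hf₁ hf₀, ?_, ?_⟩
  · intro x hx
    by_contra! hlt
    refine hx ?_
    rw [hφx]
    refine max_eq_left ((min_le_right _ _).trans ?_)
    rw [sub_nonpos, div_le_one hδ]
    change 2 * ‖f₀ x - f₁ x‖ ≤ δ
    linarith
  · refine (ContinuousMap.norm_le _ hδ.le).2 fun x => ?_
    have e : (c.toComplex * f₁ + (1 - c.toComplex) * f₀ - f₀) x = -((c x : ℂ) * (f₀ x - f₁ x)) := by
      change (c x : ℂ) * f₁ x + (1 - (c x : ℂ)) * f₀ x - f₀ x = _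
      ring
    rw [e, norm_neg, norm_mul, Complex.norm_real, Real.norm_of_nonneg (hc x).1, hcx,
      div_mul_eq_mul_div, div_le_iff₀ (hmax x)]
    exact mul_le_mul_of_nonneg_left (le_max_right _ _) hδ.le
  · ext x
    change (1 - (φ x : ℂ)) * ((c x : ℂ) * f₁ x + (1 - (c x : ℂ)) * f₀ x) = (1 - (φ x : ℂ)) * f₁ x
    rcases le_total (d x) δ with hx | hx
    · rw [hcx, max_eq_left hx, div_self hδ.ne']; push_cast; ring
    · have : φ x = 1 := by
        have h1 : 1 ≤ d x / δ := (one_le_div hδ).2 hx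
        rw [hφx, min_eq_left (by rw [mul_div_assoc]; linarith), max_eq_right zero_le_one]
      rw [this]; push_cast; ring

/-- One step of the approximation: the error of a near-norming pair is made arbitrarily small at the
cost of a controlled perturbation of both the operator and the function. -/
lemma exists_improved_near_norming (T : C(K, ℂ) →L[ℂ] C(S, ℂ)) (hT : ‖T‖ ≤ 1) {f₀ : C(K, ℂ)}
    (hf₀ : ‖f₀‖ ≤ 1) {s₀ : S} {η δ : ℝ} (hη : 0 < η) (hδ : 0 < δ) (hδ1 : δ ≤ 1)
    (hηδ : 1000 * η ≤ δ ^ 2) (h₀ : 1 - η ≤ (T f₀ s₀).re) {η' : ℝ} (hη' : 0 < η') :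
    ∃ (T' : C(K, ℂ) →L[ℂ] C(S, ℂ)) (f : C(K, ℂ)) (s : S), ‖T'‖ ≤ 1 ∧ ‖f‖ ≤ 1 ∧
      1 - η' ≤ (T' f s).re ∧ ‖T' - T‖ ≤ 1000 * η / δ ^ 2 ∧ ‖f - f₀‖ ≤ δ := by
  have hδ2 : δ ^ 2 ≤ 1 := pow_le_one₀ hδ.le hδ1
  obtain ⟨R, hRT, hR1, hR⟩ := exists_boost T hT hf₀ hη (by linarith) h₀
  have hR3 : ‖R‖ ≤ 1 + 3 * η := by
    have := norm_add_le (R - T) T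
    rw [sub_add_cancel] at this
    linarith
  -- η/2 keeps ‖R‖ - 2ε ≥ 1, so the boost applies; η'/6 absorbs the normalization by ‖R‖ + 6ε.
  set ε := min (η / 2) (η' / 6) with hε
  have hε0 : 0 < ε := lt_min (by linarith) (by linarith)
  have hε1 : ε ≤ η / 2 := min_le_left _ _
  have hε2 : ε ≤ η' / 6 := min_le_right _ _
  obtain ⟨f₁, hf₁, s₁, hs₁⟩ := exists_lt_re_apply R (r := ‖R‖ - ε) (by linarith) (by linarith)
  obtain ⟨φ, f, hφ, hsupp, hf, hff₀, hφf⟩ := exists_clip f₀ f₁ hf₀ hf₁ hδ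
  set τ := 32 * (4 * η) / δ ^ 2 with hτ
  have hδ2' : 0 < δ ^ 2 := by positivity
  have hτδ : τ * δ ^ 2 = 128 * η := by rw [hτ]; field_simp; ring
  have hτ1 : τ ≤ 1 / 4 := by rw [hτ, div_le_iff₀ hδ2']; linarith
  have hητ : η ≤ τ := by nlinarith
  have hsmall : ∀ s, ‖R‖ - 2 * ε < (R f₁ s).re → ∀ g : C(K, ℂ), ‖g‖ ≤ 1 →
      ‖R (φ.toComplex * g) s‖ ≤ τ := by
    intro s hs g hg
    have h2 : 1 < ‖R f₁ s‖ := lt_of_lt_of_le (by linarith) (Complex.re_le_norm _)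
    have h3 : ‖evalFunctional R s‖ ≤ (R f₁ s).re + 4 * η := by
      have : ‖evalFunctional R s‖ ≤ ‖R‖ := opNorm_le_of_forall_norm_le_one _ (norm_nonneg _)
        fun k hk => norm_apply_apply_le R hk s
      linarith
    exact norm_apply_mul_le_of_two_near_norming (evalFunctional R s) hφ hf₀ hf₁ hδ hδ1
      (hR s f₁ hf₁ h2) h3 hsupp hg
  obtain ⟨Q, hQ, hQR, hQs⟩ := exists_cut R (by linarith) hf₁ hε0 hs₁.le hφ (by linarith) hsmall
  set β := ‖R‖ + 6 * ε with hβ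
  have hβ1 : 1 ≤ β := by linarith
  have hβ0 : 0 < β := by linarith
  have hQβ : ‖((β⁻¹ : ℝ) : ℂ) • Q - Q‖ ≤ β - 1 := by
    have : ((β⁻¹ : ℝ) : ℂ) • Q - Q = ((β⁻¹ - 1 : ℝ) : ℂ) • Q := by
      ext k t
      change ((β⁻¹ : ℝ) : ℂ) * Q k t - Q k t = ((β⁻¹ - 1 : ℝ) : ℂ) * Q k t
      push_cast; ring
    have h1 : β⁻¹ ≤ 1 := inv_le_one_of_one_le₀ hβ1
    rw [this, norm_smul, Complex.norm_real, Real.norm_of_nonpos (by linarith)]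
    calc -(β⁻¹ - 1) * ‖Q‖ ≤ -(β⁻¹ - 1) * β := mul_le_mul_of_nonneg_left hQ (by linarith)
      _ = β - 1 := by field_simp; ring
  refine ⟨((β⁻¹ : ℝ) : ℂ) • Q, f, s₁, ?_, hf, ?_, ?_, hff₀⟩
  · rw [norm_smul, Complex.norm_real, Real.norm_of_nonneg (by positivity), inv_mul_le_iff₀ hβ0]
    linarith
  · change _ ≤ (((β⁻¹ : ℝ) : ℂ) * Q f s₁).re
    rw [Complex.re_ofReal_mul, hQs f hφf, ← div_eq_inv_mul, le_div_iff₀ hβ0]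
    nlinarith
  · have h1 := norm_add_le (((β⁻¹ : ℝ) : ℂ) • Q - Q) ((Q - R) + (R - T))
    have h2 := norm_add_le (Q - R) (R - T)
    have e : ((β⁻¹ : ℝ) : ℂ) • Q - Q + ((Q - R) + (R - T)) = ((β⁻¹ : ℝ) : ℂ) • Q - T := by abel
    rw [e] at h1
    have h3 : 2 * ‖R‖ * (ε + τ) ≤ 4 * (η + τ) := by
      have : ‖R‖ ≤ 2 := by linarith
      have : ‖R‖ * (ε + τ) ≤ 2 * (η + τ) := by gcongr; linarith
      linarith
    rw [le_div_iff₀ hδ2']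
    -- Normalization costs 6η, the cut τ + 4(η + τ), the boost 3η.
    have h4 : ‖((β⁻¹ : ℝ) : ℂ) • Q - T‖ ≤ 13 * η + 5 * τ := by linarith
    nlinarith

end Operator

/-- A contraction together with a function in the unit ball and a point at which the function
norms the contraction up to `η`. -/
structure NearNorming (K S : Type*) [TopologicalSpace K] [CompactSpace K] [TopologicalSpace S]
    [CompactSpace S] (η : ℝ) where
  op : C(K, ℂ) →L[ℂ] C(S, ℂ)
  fn : C(K, ℂ)
  pt : S
  norm_op_le : ‖op‖ ≤ 1
  norm_fn_le : ‖fn‖ ≤ 1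
  near : 1 - η ≤ (op fn pt).re

/-! ### Iteration and passage to the limit -/

section Limit

variable {K S : Type*} [TopologicalSpace K] [CompactSpace K]
  [TopologicalSpace S] [CompactSpace S] [T2Space S]

lemma exists_normAttaining_of_norm_eq_one (T : C(K, ℂ) →L[ℂ] C(S, ℂ)) (hT : ‖T‖ = 1) {ε : ℝ}
    (hε : 0 < ε) (hε1 : ε ≤ 1) :
    ∃ T' : C(K, ℂ) →L[ℂ] C(S, ℂ), NormAttaining T' ∧ ‖T - T'‖ ≤ 2 * ε := by
  -- With δₙ = 2⁻ⁿ, the operator moves 1000ηₙ/δₙ² = ε2⁻ⁿ sum to 2ε.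
  let η : ℕ → ℝ := fun n => ε * (1 / 8) ^ n / 1000
  have hη : ∀ n, 0 < η n := fun n => by positivity
  have hδsq : ∀ n : ℕ, ((1 / 2 : ℝ) ^ n) ^ 2 = (1 / 4) ^ n := fun n => by
    rw [← pow_mul, mul_comm, pow_mul]; norm_num
  have h84 : ∀ n : ℕ, (1 / 8 : ℝ) ^ n = (1 / 2) ^ n * (1 / 4) ^ n := fun n => by
    rw [← mul_pow]; norm_num
  have hη1000 : ∀ n, 1000 * η n = ε * (1 / 2) ^ n * (1 / 4) ^ n := fun n => by
    simp only [η, h84]; ring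
  have step : ∀ n (σ : NearNorming K S (η n)), ∃ σ' : NearNorming K S (η (n + 1)),
      ‖σ'.op - σ.op‖ ≤ ε * (1 / 2) ^ n ∧ ‖σ'.fn - σ.fn‖ ≤ (1 / 2) ^ n := by
    intro n σ
    obtain ⟨T', f, s, h1, h2, h3, h4, h5⟩ := exists_improved_near_norming σ.op σ.norm_op_le
      σ.norm_fn_le (hη n) (δ := (1 / 2) ^ n) (by positivity)
      (pow_le_one₀ (by norm_num) (by norm_num)) (by
        rw [hη1000, hδsq]
        have : (1 / 2 : ℝ) ^ n ≤ 1 := pow_le_one₀ (by norm_num) (by norm_num)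
        refine mul_le_of_le_one_left (by positivity) ?_
        exact mul_le_one₀ hε1 (by positivity) this) σ.near (hη (n + 1))
    refine ⟨⟨T', f, s, h1, h2, h3⟩, ?_, h5⟩
    rwa [hη1000, hδsq, mul_div_cancel_right₀ _ (by positivity)] at h4
  obtain ⟨f₀, hf₀, s₀, hs₀⟩ := exists_lt_re_apply T (r := 1 - η 0)
    (by simp only [η]; linarith) (by have := hη 0; linarith)
  choose next hop hfn using step
  let σ : ∀ n, NearNorming K S (η n) := fun n =>
    Nat.rec ⟨T, f₀, s₀, hT.le, hf₀, hs₀.le⟩ (fun n σ => next n σ) n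
  have hop' : ∀ n, dist (σ n).op (σ (n + 1)).op ≤ 2 * ε / 2 / 2 ^ n := fun n => by
    rw [dist_comm, dist_eq_norm]
    refine (hop n (σ n)).trans (le_of_eq ?_)
    rw [one_div, inv_pow]; ring
  have hfn' : ∀ n, dist (σ n).fn (σ (n + 1)).fn ≤ 2 / 2 / 2 ^ n := fun n => by
    rw [dist_comm, dist_eq_norm]
    refine (hfn n (σ n)).trans (le_of_eq ?_)
    rw [one_div, inv_pow]; ring
  obtain ⟨T', hT'⟩ := cauchySeq_tendsto_of_complete (cauchySeq_of_le_geometric_two hop')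
  obtain ⟨f, hf⟩ := cauchySeq_tendsto_of_complete (cauchySeq_of_le_geometric_two hfn')
  have hdist : dist T T' ≤ 2 * ε := dist_le_of_le_geometric_two_of_tendsto₀ hop' hT'
  have hT'1 : ‖T'‖ ≤ 1 := le_of_tendsto hT'.norm (Filter.Eventually.of_forall fun n =>
    (σ n).norm_op_le)
  have hf1 : ‖f‖ ≤ 1 := le_of_tendsto hf.norm (Filter.Eventually.of_forall fun n =>
    (σ n).norm_fn_le)
  have hη0 : Filter.Tendsto (fun n => 1 - η n) Filter.atTop (nhds 1) := by
    have := ((tendsto_pow_atTop_nhds_zero_of_lt_one (r := (1 / 8 : ℝ)) (by norm_num)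
      (by norm_num)).const_mul ε).div_const 1000
    simpa [η] using this.const_sub 1
  have hlim : Filter.Tendsto (fun n => (σ n).op (σ n).fn) Filter.atTop (nhds (T' f)) :=
    ((isBoundedBilinearMap_apply (𝕜 := ℂ)).continuous.tendsto (T', f)).comp (hT'.prodMk_nhds hf)
  have h1 : 1 ≤ ‖T' f‖ := le_of_tendsto_of_tendsto' hη0 hlim.norm fun n =>
    (σ n).near.trans ((Complex.re_le_norm _).trans (ContinuousMap.norm_coe_le_norm _ _))
  have h2 := T'.le_opNorm f
  have h3 : 1 ≤ ‖f‖ := by nlinarith [norm_nonneg f, norm_nonneg T']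
  have h4 : ‖f‖ = 1 := le_antisymm hf1 h3
  rw [h4, mul_one] at h2
  exact ⟨T', ⟨f, h4, by linarith⟩, by rwa [← dist_eq_norm]⟩

end Limit

lemma NormAttaining.smul {X Y : Type*} [NormedAddCommGroup X] [NormedSpace ℂ X]
    [NormedAddCommGroup Y] [NormedSpace ℂ Y] {T : X →L[ℂ] Y} (hT : NormAttaining T) (c : ℂ) :
    NormAttaining (c • T) := by
  obtain ⟨x, hx, hTx⟩ := hT
  exact ⟨x, hx, by rw [_root_.smul_apply, norm_smul, norm_smul, hTx]⟩

theorem mainTheorem1 {K S : Type*}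
    [TopologicalSpace K] [CompactSpace K] [T2Space K] [Nonempty K]
    [TopologicalSpace S] [CompactSpace S] [T2Space S] :
    closure {T : C(K, ℂ) →L[ℂ] C(S, ℂ) | NormAttaining T} = Set.univ := by
  refine Set.eq_univ_of_forall fun T => ?_
  rcases eq_or_ne T 0 with rfl | hT
  -- The constant 1 has norm one because `K` is nonempty.
  · exact subset_closure ⟨1, norm_one, by simp⟩
  have hN : 0 < ‖T‖ := (norm_nonneg T).lt_of_ne' fun h => hT (T.opNorm_zero_iff.1 h)
  have hN' : (‖T‖ : ℂ) ≠ 0 := by exact_mod_cast hN.ne'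
  refine Metric.mem_closure_iff.2 fun r hr => ?_
  set ε := min 1 (r / (4 * ‖T‖)) with hε
  obtain ⟨T', hT', hd⟩ := exists_normAttaining_of_norm_eq_one ((‖T‖ : ℂ)⁻¹ • T)
    (by rw [norm_smul, norm_inv, Complex.norm_real, norm_norm, inv_mul_cancel₀ hN.ne'])
    (ε := ε) (lt_min one_pos (by positivity)) (min_le_left _ _)
  refine ⟨(‖T‖ : ℂ) • T', hT'.smul _, ?_⟩
  have e : T - (‖T‖ : ℂ) • T' = (‖T‖ : ℂ) • ((‖T‖ : ℂ)⁻¹ • T - T') := by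
    rw [smul_sub, smul_inv_smul₀ hN']
  rw [dist_eq_norm, e, norm_smul, Complex.norm_real, norm_norm]
  calc ‖T‖ * ‖(‖T‖ : ℂ)⁻¹ • T - T'‖ ≤ ‖T‖ * (2 * (r / (4 * ‖T‖))) := by
        gcongr
        exact hd.trans (by linarith [min_le_right 1 (r / (4 * ‖T‖))])
    _ = r / 2 := by field_simp; ring
    _ < r := by linarith
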